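/- A pushdown automaton (PDA) is a tuple $P=(Q,\Sigma,\Gamma,\delta,q_0,Z_0,F)$ with finite sets $Q$ of states, $\Sigma$ of input letters and $\Gamma$ of stack symbols, a transition function $\delta: Q\times(\Sigma\cup\{\varepsilon\})\times\Gamma\to 2^{Q\times\Gamma^{\le 2}}$, an initial state $q_0\in Q$, an initial stack symbol $Z_0\in\Gamma$ and a set $F\subseteq Q$ of accepting states. A configuration is a pair in $Q\times\Gamma^*$; the language $L(P)\subseteq\Sigma^*$ consists of the words $w$ that label a finite sequence of transitions from $(q_0,Z_0)$ to a configuration whose state is in $F$. For $k\in\mathbb N$, the $k$-explorability game on $P$ is played with $k$ tokens, all placed initially on $(q_0,Z_0)$. In round $i\ge 1$, Spoiler chooses a letter $a_i\in\Sigma$, and then Determiner moves every token along some path of transitions of the form $\xrightarrow{\varepsilon}\cdots\xrightarrow{\varepsilon}\xrightarrow{a_i}$ (with zero or more $\varepsilon$-transitions). Determiner wins the play if for every $n$ with $a_1\cdots a_n\in L(P)$, some token is in a state of $F$ after round $n$ (for $n=0$: in the initial position). The PDA $P$ is $k$-explorable if Determiner has a winning strategy. Over a finite alphabet $\Sigma$,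 let $\mathsf{Expl}_k\text{-}\mathsf{CFL}$ be the class of languages recognised by $k$-explorable PDAs, let $\mathsf{Expl}\text{-}\mathsf{CFL}=\bigcup_{k\in\mathbb N}\mathsf{Expl}_k\text{-}\mathsf{CFL}$, and let $\mathsf{CFL}$ be the class of context-free languages. **Theorem.** $\mathsf{Expl}\text{-}\mathsf{CFL}\subsetneq\mathsf{CFL}$. More precisely, $\mathsf{Expl}\text{-}\mathsf{CFL}\subseteq\mathsf{CFL}$ over every finite alphabet, and over the alphabet $\{a,\#,b\}$ the inclusion is strict: the language $$L_{block}=\{a^{m_1}\#a^{m_2}\#\cdots a^{m_r}\#\,b^n \;:\; r\ge 1,\ m_1,\dots,m_r\ge 0,\ n\in\{m_1,\dots,m_r\}\}$$ is context-free, but for no $k\in\mathbb N$ is it recognised by a $k$-explorable PDA. -/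

import Mathlib

/-- A nondeterministic pushdown automaton over the input alphabet `α`, with finitely many states and
stack symbols. In `δ q x X`, the value `x = none` stands for an `ε`-transition; a transition replaces
the topmost stack symbol `X` by a string of at most two stack symbols. -/
structure PDA (α : Type*) where
  /-- States. -/
  Q : Type
  /-- Stack symbols. -/
  Γ : Type
  finite_Q : Finite Q
  finite_Γ : Finite Γ
  /-- Transition function. -/
  δ : Q → Option α → Γ → Set (Q × {γ : List Γ // γ.length ≤ 2})
  /-- Initial state. -/
  q₀ : Q
  /-- Initial stack symbol. -/
  Z₀ : Γ
  /-- Accepting states. -/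
  F : Set Q

namespace PDA

/-- A configuration: the control state and the stack content, whose head is the top of the stack. -/
abbrev Config {α : Type*} (P : PDA α) : Type := P.Q × List P.Γ

/-- The initial configuration. -/
def init {α : Type*} (P : PDA α) : P.Config := (P.q₀, [P.Z₀])

/-- One transition, labelled by a letter or by `ε` (`none`). Nothing is enabled on the empty stack. -/
inductive Move {α : Type*} (P : PDA α) : Option α → P.Config → P.Config → Prop
  | mk {x : Option α} {q q' : P.Q} {X : P.Γ} {γ : {γ : List P.Γ // γ.length ≤ 2}}
      (h : (q', γ) ∈ P.δ q x X) (β : List P.Γ) : Move P x (q, X :: β) (q', γ.1 ++ β)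

/-- `P.Run c w c'`: some finite sequence of transitions leads from `c` to `c'` and has label `w`,
where `ε`-transitions contribute nothing to the label. -/
inductive Run {α : Type*} (P : PDA α) : P.Config → List α → P.Config → Prop
  | refl (c : P.Config) : Run P c [] c
  | eps {c d e : P.Config} {w : List α} (h : P.Move none c d) (hr : Run P d w e) : Run P c w e
  | letter {c d e : P.Config} {a : α} {w : List α} (h : P.Move (some a) c d) (hr : Run P d w e) :
      Run P c (a :: w) e

/-- The language recognised by `P`, by acceptance in an accepting state. -/
def language {α : Type*} (P : PDA α) : Language α :=
  {w | ∃ c : P.Config, P.Run P.init w c ∧ c.1 ∈ P.F}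

/-- A legal move of one token when the letter `a` is played: a path of the form
`ε ⋯ ε a`, that is, finitely many `ε`-transitions followed by one transition that reads `a`. -/
def TokenStep {α : Type*} (P : PDA α) (a : α) (c c' : P.Config) : Prop :=
  ∃ d : P.Config, Relation.ReflTransGen (P.Move none) c d ∧ P.Move (some a) d c'

/-- A strategy of Determiner in the `k`-explorability game on `P`: `conf w` is the `k`-tuple of
configurations that she has reached after Spoiler has played the letters of `w`, one at a time.
(As her strategy is deterministic, the letters played so far determine the whole history.)
All tokens start in the initial configuration, and in every round every token makes a legal move. -/
structure Strategy {α : Type*} (P : PDA α) (k : ℕ) where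
  /-- The tuple of configurations after each finite word. -/
  conf : List α → Fin k → P.Config
  conf_nil : ∀ l, conf [] l = P.init
  conf_append : ∀ (w : List α) (a : α) (l : Fin k), P.TokenStep a (conf w l) (conf (w ++ [a]) l)

/-- The strategy wins every play: whenever the word played so far is in the language of `P`, the
sequence of configurations of some token is an accepting run on it, i.e. it is now in an accepting
state. -/
def Strategy.Winning {α : Type*} {P : PDA α} {k : ℕ} (σ : P.Strategy k) : Prop :=
  ∀ w ∈ P.language, ∃ l : Fin k, (σ.conf w l).1 ∈ P.F

/-- `P` is `k`-explorable: Determiner has a winning strategy in the `k`-explorability game. -/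
def IsExplorable {α : Type*} (P : PDA α) (k : ℕ) : Prop :=
  ∃ σ : P.Strategy k, σ.Winning

end PDA

/-- The class of languages over `α` recognised by `k`-explorable pushdown automata. -/
def ExplCFLWith (α : Type*) (k : ℕ) : Set (Language α) :=
  {L | ∃ P : PDA α, P.IsExplorable k ∧ P.language = L}

/-- The class of languages over `α` recognised by explorable pushdown automata. -/
def ExplCFL (α : Type*) : Set (Language α) := ⋃ k : ℕ, ExplCFLWith α k

/-- The class of context-free languages over `α`. -/
def CFL (α : Type*) : Set (Language α) := {L | L.IsContextFree}

/-- The alphabet `{a, #, b}`; `sep` is the separator `#`. -/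
inductive BlockLetter : Type
  | a
  | sep
  | b

/-- The words `a^{m₁} # a^{m₂} # ⋯ a^{mᵣ} # bⁿ` such that `n` is one of `m₁, …, mᵣ`. -/
def blockLanguage : Language BlockLetter :=
  {w | ∃ (ms : List ℕ) (n : ℕ), n ∈ ms ∧
    w = (ms.map fun m => List.replicate m BlockLetter.a ++ [BlockLetter.sep]).flatten ++
      List.replicate n BlockLetter.b}

/-! The triple construction shows that every pushdown automaton over a finite alphabet has a
context-free language.

Suppose that Determiner wins with `k` tokens on an automaton for `blockLanguage`. For the blocks of
lengths `n, …, n + k`, Spoiler plays the block word followed by `n + k` letters `b`. The `k + 1`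
prefixes with at least `n` letters `b` are all in the language, so some token is in an accepting
state after two of them: one run accepts with `p` letters `b`, and goes on to accept with `q > p` of
them. Tag the letters of such a run by whether they come before or after the former acceptance. The
tagged words of this kind form a context-free language, in which both `p` and `q` are block lengths.
Pumping the `b`s counted by `p` makes `p` and `q` arbitrarily large, and it pumps the blocks at one
place only. But this makes at most one block long. -/

section Grammars

variable {T N : Type*} {R : Set (ContextFreeRule T N)}

/-- `Parses R s w`: the word `w` arises from the sentential form `s` when every nonterminal of `s`
is expanded by rules of `R`. A proof is a derivation forest in binary form (first child, next
sibling), so that each node is labelled by a suffix of the right-hand side of some rule. -/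
inductive Parses (R : Set (ContextFreeRule T N)) : List (Symbol T N) → List T → Prop
  | nil : Parses R [] []
  | terminal (a : T) {s : List (Symbol T N)} {w : List T} (hw : Parses R s w) :
      Parses R (.terminal a :: s) (a :: w)
  | nonterminal {r : ContextFreeRule T N} {s : List (Symbol T N)} {v w : List T} (hr : r ∈ R)
      (hv : Parses R r.output v) (hw : Parses R s w) :
      Parses R (.nonterminal r.input :: s) (v ++ w)

namespace Parses

theorem map_terminal (w : List T) : Parses R (w.map .terminal) w := by
  induction w with
  | nil => exact .nil
  | cons a w ih => exact ih.terminal a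

theorem of_mem {r : ContextFreeRule T N} {w : List T} (hr : r ∈ R) (hw : Parses R r.output w) :
    Parses R [.nonterminal r.input] w := by
  simpa using nonterminal hr hw .nil

theorem append {s t : List (Symbol T N)} {v w : List T} (hv : Parses R s v) (hw : Parses R t w) :
    Parses R (s ++ t) (v ++ w) := by
  induction hv with
  | nil => exact hw
  | terminal a _ ih => exact ih.terminal a
  | nonterminal hr hv _ _ ih => simpa using nonterminal hr hv ih

theorem exists_of_append {s t : List (Symbol T N)} {w : List T} (h : Parses R (s ++ t) w) :
    ∃ u v, w = u ++ v ∧ Parses R s u ∧ Parses R t v := by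
  induction s generalizing w with
  | nil => exact ⟨[], w, rfl, .nil, h⟩
  | cons _ s ih =>
    cases h with
    | terminal a hw =>
      obtain ⟨u, v, rfl, hu, hv⟩ := ih hw
      exact ⟨a :: u, v, rfl, hu.terminal a, hv⟩
    | nonterminal hr hx hw =>
      obtain ⟨u, v, rfl, hu, hv⟩ := ih hw
      exact ⟨_ ++ u, v, by simp, nonterminal hr hx hu, hv⟩

theorem of_derives {g : ContextFreeGrammar T} {s : List (Symbol T g.NT)} {w : List T}
    (h : g.Derives s (w.map .terminal)) : Parses (g.rules : Set _) s w := by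
  induction h using Relation.ReflTransGen.head_induction_on with
  | refl => exact map_terminal w
  | head hst _ ih =>
    obtain ⟨r, hr, hst⟩ := hst
    obtain ⟨p, q, rfl, rfl⟩ := hst.exists_parts
    obtain ⟨_, v, rfl, hpr, hv⟩ := ih.exists_of_append
    obtain ⟨_, _, rfl, hp, hr'⟩ := hpr.exists_of_append
    exact (hp.append (of_mem hr hr')).append hv

theorem derives {g : ContextFreeGrammar T} {s : List (Symbol T g.NT)} {w : List T}
    (h : Parses (g.rules : Set _) s w) : g.Derives s (w.map .terminal) := by
  induction h with
  | nil => rfl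
  | terminal a _ ih => exact ih.append_left [.terminal a]
  | @nonterminal r s v w hr _ _ ihv ihw =>
    have hexpand : g.Derives (.nonterminal r.input :: s) (r.output ++ s) :=
      ContextFreeGrammar.Produces.single ⟨r, hr, .head s⟩
    rw [List.map_append]
    exact hexpand.trans ((ihv.append_right s).trans (ihw.append_left _))

end Parses

theorem isContextFree_iff_exists_parses {L : Language T} :
    L.IsContextFree ↔ ∃ (N : Type) (R : Set (ContextFreeRule T N)) (S : N), R.Finite ∧
      ∀ w, w ∈ L ↔ Parses R [.nonterminal S] w := by
  constructor
  · rintro ⟨g, rfl⟩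
    exact ⟨g.NT, g.rules, g.initial, g.rules.finite_toSet,
      fun w => ⟨.of_derives, fun h => h.derives⟩⟩
  · rintro ⟨N, R, S, hR, hL⟩
    obtain ⟨rules, rfl⟩ := hR.exists_finset_coe
    refine ⟨⟨N, S, rules⟩, ?_⟩
    ext w
    rw [hL]
    exact ⟨.of_derives, fun h => Parses.derives (g := ⟨N, S, rules⟩) h⟩

/-- The language of a sentential form when each nonterminal `A` stands for the language `I A`. -/
def interpret (I : N → Language T) : List (Symbol T N) → Language T
  | [] => 1
  | .terminal a :: s => {[a]} * interpret I s
  | .nonterminal A :: s => I A * interpret I s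

theorem Parses.mem_interpret {I : N → Language T}
    (hI : ∀ r ∈ R, interpret I r.output ≤ I r.input) {s : List (Symbol T N)} {w : List T}
    (h : Parses R s w) : w ∈ interpret I s := by
  induction h with
  | nil => exact Language.nil_mem_one
  | terminal a _ ih => exact Language.append_mem_mul (a := [a]) rfl ih
  | nonterminal hr _ _ ihv ihw => exact Language.append_mem_mul (hI _ hr ihv) ihw

end Grammars

section Pumping

variable {T N : Type*} {R : Set (ContextFreeRule T N)} {s t r : List (Symbol T N)}

/-- `Context R s u t z`: a derivation from `t` can be completed to one from `s` which has `u` to the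
left and `z` to the right. -/
def Context (R : Set (ContextFreeRule T N)) (s : List (Symbol T N)) (u : List T)
    (t : List (Symbol T N)) (z : List T) : Prop :=
  ∀ x, Parses R t x → Parses R s (u ++ x ++ z)

namespace Context

theorem refl (s : List (Symbol T N)) : Context R s [] s [] := fun x hx => by simpa using hx

theorem trans {u v y z : List T} (h : Context R s u t z) (h' : Context R t v r y) :
    Context R s (u ++ v) r (y ++ z) := fun x hx => by
  simpa using h _ (h' x hx)

theorem iterate {v y : List T} (h : Context R s v s y) (i : ℕ) :
    Context R s (List.replicate i v).flatten s (List.replicate i y).flatten := by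
  induction i with
  | zero => exact refl s
  | succ i ih =>
    rw [List.replicate_succ, List.replicate_succ', List.flatten_cons, List.flatten_append]
    simpa using h.trans ih

end Context

/-- The derivation of `w` from `s` passes through a sentential form in `S`. -/
def PassesThrough (R : Set (ContextFreeRule T N)) (S : Finset (List (Symbol T N)))
    (s : List (Symbol T N)) (w : List T) : Prop :=
  ∃ t ∈ S, ∃ u x z, w = u ++ x ++ z ∧ Context R s u t z ∧ Parses R t x

/-- The derivation of `w` from `s` contains a loop, from a sentential form to itself, which produces
a letter marked by `p`. -/
def HasMarkedLoop (R : Set (ContextFreeRule T N)) (p : T → Bool) (s : List (Symbol T N))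
    (w : List T) : Prop :=
  ∃ t u v x y z, w = u ++ v ++ x ++ y ++ z ∧ Context R s u t z ∧ Context R t v t y ∧
    Parses R t x ∧ 0 < (v ++ y).countP p

variable {p : T → Bool} {u x z w : List T} {S F : Finset (List (Symbol T N))}

theorem PassesThrough.of_context (hC : Context R s u t z) (h : PassesThrough R S t x) :
    PassesThrough R S s (u ++ x ++ z) := by
  obtain ⟨t', ht', u', x, z', rfl, hC', hx⟩ := h
  exact ⟨t', ht', u ++ u', x, z' ++ z, by simp, hC.trans hC', hx⟩

theorem HasMarkedLoop.of_context (hC : Context R s u t z) (h : HasMarkedLoop R p t x) :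
    HasMarkedLoop R p s (u ++ x ++ z) := by
  obtain ⟨t', u', v, x, y, z', rfl, hC', hloop, hx, hp⟩ := h
  exact ⟨t', u ++ u', v, x, y, z' ++ z, by simp, hC.trans hC', hloop, hx, hp⟩

/-- A return to `s` below the child `t` is a marked loop as soon as some marked letter lies
outside `x`. -/
theorem HasMarkedLoop.of_passesThrough_insert [DecidableEq (List (Symbol T N))]
    (hC : Context R s u t z) (h : PassesThrough R (insert s S) t x)
    (hp : x.countP p < (u ++ x ++ z).countP p) :
    HasMarkedLoop R p s (u ++ x ++ z) ∨ PassesThrough R S s (u ++ x ++ z) := by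
  obtain ⟨t', ht', u', x, z', rfl, hC', hx⟩ := h
  rcases Finset.mem_insert.1 ht' with rfl | ht'
  · refine .inl ⟨t', [], u ++ u', x, z' ++ z, [], by simp, .refl t', hC.trans hC', hx, ?_⟩
    simp only [List.countP_append] at hp ⊢
    omega
  · exact .inr (.of_context hC ⟨t', ht', u', x, z', rfl, hC', hx⟩)

/-- The induction step of `hasMarkedLoop_or_passesThrough`: pass to a child `t` that carries at
least half of the marked letters. -/
theorem hasMarkedLoop_or_passesThrough_of_child [DecidableEq (List (Symbol T N))]
    (hC : Context R s u t z) (hx : Parses R t x)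
    (ih : ∀ S : Finset (List (Symbol T N)), 2 ^ (F \ S).card ≤ x.countP p →
      HasMarkedLoop R p t x ∨ PassesThrough R S t x)
    (hs : s ∈ F) (hS : 2 ^ (F \ S).card ≤ (u ++ x ++ z).countP p)
    (hhalf : 2 ≤ (u ++ x ++ z).countP p → (u ++ x ++ z).countP p ≤ 2 * x.countP p) :
    HasMarkedLoop R p s (u ++ x ++ z) ∨ PassesThrough R S s (u ++ x ++ z) := by
  by_cases hsS : s ∈ S
  · exact .inr ⟨s, hsS, [], u ++ x ++ z, [], by simp, .refl s, hC x hx⟩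
  have hle : x.countP p ≤ (u ++ x ++ z).countP p := by
    simp only [List.countP_append]
    lia
  rcases hle.eq_or_lt with heq | hlt
  · exact (ih S (heq ▸ hS)).imp (.of_context hC) (.of_context hC)
  · have hcard : (F \ S).card = (F \ insert s S).card + 1 := by
      rw [Finset.sdiff_insert, Finset.card_erase_add_one (Finset.mem_sdiff.2 ⟨hs, hsS⟩)]
    rw [hcard, pow_succ] at hS
    have hpos : 0 < 2 ^ (F \ insert s S).card := by positivity
    rcases ih (insert s S) (by lia) with hloop | hpass
    · exact .inl (.of_context hC hloop)
    · exact HasMarkedLoop.of_passesThrough_insert hC hpass hlt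

theorem hasMarkedLoop_or_passesThrough [DecidableEq (List (Symbol T N))]
    (htail : ∀ a s, a :: s ∈ F → s ∈ F) (hrule : ∀ r ∈ R, r.output ∈ F) (hw : Parses R s w)
    (hs : s ∈ F) (hS : 2 ^ (F \ S).card ≤ w.countP p) :
    HasMarkedLoop R p s w ∨ PassesThrough R S s w := by
  induction hw generalizing S with
  | nil => exact absurd hS (by simp)
  | @terminal a s w hw ih =>
    have hC : Context R (.terminal a :: s) [a] s [] := fun x hx => by simpa using hx.terminal a
    have hhalf : 2 ≤ (a :: w).countP p → (a :: w).countP p ≤ 2 * w.countP p := by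
      rw [List.countP_cons]
      grind
    simpa using hasMarkedLoop_or_passesThrough_of_child hC hw (fun S => ih (htail _ _ hs)) hs
      (by simpa using hS) (by simpa using hhalf)
  | @nonterminal r s v w hr hv hw ihv ihw =>
    rcases le_total (v.countP p) (w.countP p) with hle | hle
    · have hC : Context R (.nonterminal r.input :: s) v s [] := fun x hx => by
        simpa using Parses.nonterminal hr hv hx
      simpa using hasMarkedLoop_or_passesThrough_of_child hC hw (fun S => ihw (htail _ _ hs)) hs
        (by simpa using hS) (fun _ => by simp only [List.countP_append, List.countP_nil]; lia)
    · have hC : Context R (.nonterminal r.input :: s) [] r.output w := fun x hx => by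
        simpa using Parses.nonterminal hr hx hw
      simpa using hasMarkedLoop_or_passesThrough_of_child hC hv (fun S => ihv (hrule r hr)) hs
        (by simpa using hS) (fun _ => by simp only [List.countP_append, List.countP_nil]; lia)

theorem exists_finset_forms (hR : R.Finite) (s₀ : List (Symbol T N)) :
    ∃ F : Finset (List (Symbol T N)), s₀ ∈ F ∧ (∀ r ∈ R, r.output ∈ F) ∧
      ∀ a s, a :: s ∈ F → s ∈ F := by
  have hfin : {t | t <:+ s₀ ∨ ∃ r ∈ R, t <:+ r.output}.Finite := by
    have hsuffixes : ∀ s : List (Symbol T N), {t | t <:+ s}.Finite := fun s =>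
      s.tails.finite_toSet.subset fun t ht => (List.mem_tails t s).2 ht
    refine ((hsuffixes s₀).union (hR.biUnion fun r _ => hsuffixes r.output)).subset fun t ht => ?_
    simpa using ht
  refine ⟨hfin.toFinset, ?_, fun r hr => ?_, fun a s h => ?_⟩
  · simp
  · exact hfin.mem_toFinset.2 (.inr ⟨r, hr, List.suffix_rfl⟩)
  · have hs : s <:+ a :: s := List.suffix_cons a s
    exact hfin.mem_toFinset.2 ((hfin.mem_toFinset.1 h).imp hs.trans
      fun ⟨r, hr, h⟩ => ⟨r, hr, hs.trans h⟩)

/-- Ogden's lemma, without its bound on the pumped part. -/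
theorem exists_marked_pumping {L : Language T} (hL : L.IsContextFree) (p : T → Bool) :
    ∃ n, ∀ w ∈ L, n ≤ w.countP p → ∃ u v x y z, w = u ++ v ++ x ++ y ++ z ∧
      0 < (v ++ y).countP p ∧
      ∀ i, u ++ (List.replicate i v).flatten ++ x ++ (List.replicate i y).flatten ++ z ∈ L := by
  classical
  obtain ⟨N, R, S, hR, hL⟩ := isContextFree_iff_exists_parses.1 hL
  obtain ⟨F, hS, hrule, htail⟩ := exists_finset_forms hR [.nonterminal S]
  refine ⟨2 ^ F.card, fun w hw hn => ?_⟩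
  rcases hasMarkedLoop_or_passesThrough (S := ∅) htail hrule ((hL w).1 hw) hS (by simpa using hn)
    with ⟨t, u, v, x, y, z, rfl, hout, hloop, hx, hmarked⟩ | ⟨t, ht, -⟩
  · refine ⟨u, v, x, y, z, rfl, hmarked, fun i => (hL _).2 ?_⟩
    simpa using hout _ (hloop.iterate i x hx)
  · simp at ht

end Pumping

theorem finite_of_output_length_le {T N : Type*} [Finite T] [Finite N]
    {R : Set (ContextFreeRule T N)} (n : ℕ) (hR : ∀ r ∈ R, r.output.length ≤ n) : R.Finite := by
  have := Fintype.ofFinite T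
  have := Fintype.ofFinite N
  refine ((Set.finite_univ.prod (List.finite_length_le (Symbol T N) n)).image
    fun x => ContextFreeRule.mk x.1 x.2).subset fun r hr => ?_
  exact ⟨(r.input, r.output), ⟨trivial, hR r hr⟩, rfl⟩

namespace PDA

variable {α : Type*} {P : PDA α}

theorem Run.trans {c d e : P.Config} {v w : List α} (h : P.Run c v d) (h' : P.Run d w e) :
    P.Run c (v ++ w) e := by
  induction h with
  | refl => exact h'
  | eps hm _ ih => exact .eps hm (ih h')
  | letter hm _ ih => exact .letter hm (ih h')

theorem Run.cons {x : Option α} {c d e : P.Config} {w : List α} (h : P.Move x c d)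
    (h' : P.Run d w e) : P.Run c (x.toList ++ w) e := by
  cases x with
  | none => exact .eps h h'
  | some a => exact .letter h h'

@[elab_as_elim]
theorem Run.rec_cons {e : P.Config} {motive : ∀ c w, P.Run c w e → Prop}
    (refl : motive e [] (.refl e))
    (cons : ∀ {x : Option α} {c d : P.Config} {w : List α} (hm : P.Move x c d) (hr : P.Run d w e),
      motive d w hr → motive c (x.toList ++ w) (Run.cons hm hr)) {c : P.Config} {w : List α}
    (h : P.Run c w e) : motive c w h := by
  induction h with
  | refl => exact refl
  | eps hm hr ih => exact cons (x := none) hm hr (ih refl cons)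
  | letter hm hr ih => exact cons (x := some _) hm hr (ih refl cons)

section Triples

variable (P)

/-- The nonterminals `(p, X, q)` of the triple construction: `X` is popped on a path from `p` to
`q`. The pseudo-state `none` means that the run has already accepted; it pops the rest of the stack
without reading letters. -/
abbrev Triple : Type := Option P.Q × P.Γ × Option P.Q

/-- The pseudo-states in which the grammar may stop: accepting states, and `none`. -/
def Accepting (o : Option P.Q) : Prop := ∀ p ∈ o, p ∈ P.F

variable {P} in
/-- `Links o β o' s`: the sentential form `s` pops the symbols of `β` one after the other, on a path
from `o` to `o'` through guessed intermediate pseudo-states. -/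
inductive Links :
    Option P.Q → List P.Γ → Option P.Q → List (Symbol α (Option P.Triple)) → Prop
  | nil (o : Option P.Q) : Links o [] o []
  | cons {o₁ o₂ : Option P.Q} {β : List P.Γ} {s : List (Symbol α (Option P.Triple))}
      (h : Links o₁ β o₂ s) (o : Option P.Q) (X : P.Γ) :
      Links o (X :: β) o₂ (.nonterminal (some (o, X, o₁)) :: s)

/-- The rules of the triple construction, over the triples and a start symbol `none`. -/
inductive TripleRule : ContextFreeRule α (Option P.Triple) → Prop
  | start {o : Option P.Q} (ho : P.Accepting o) :
      TripleRule ⟨none, [.nonterminal (some (some P.q₀, P.Z₀, o))]⟩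
  | halt {o : Option P.Q} (ho : P.Accepting o) (X : P.Γ) : TripleRule ⟨some (o, X, none), []⟩
  | move {p q : P.Q} {x : Option α} {X : P.Γ} {γ : {γ : List P.Γ // γ.length ≤ 2}}
      {o : Option P.Q} {s : List (Symbol α (Option P.Triple))} (h : (q, γ) ∈ P.δ p x X)
      (hs : Links (some q) γ.1 o s) :
      TripleRule ⟨some (some p, X, o), x.toList.map .terminal ++ s⟩

/-- The set of rules of the triple construction. -/
def tripleRules : Set (ContextFreeRule α (Option P.Triple)) := {r | P.TripleRule r}

/-- The words accepted from a pseudo-state with a given stack. -/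
def AcceptsFrom : Option P.Q → List P.Γ → Language α
  | some p, β => {w | ∃ c, P.Run (p, β) w c ∧ c.1 ∈ P.F}
  | none, _ => 1

/-- The intended languages of the nonterminals of the triple construction. -/
def tripleLanguage : Option P.Triple → Language α
  | none => P.language
  | some (o, X, o') =>
    {v | ∀ β, ∀ w ∈ P.AcceptsFrom o' β, v ++ w ∈ P.AcceptsFrom o (X :: β)}

variable {P} {o o' : Option P.Q} {β γ : List P.Γ} {s : List (Symbol α (Option P.Triple))}
  {v w : List α}

theorem Links.length_eq (h : Links o β o' s) : s.length = β.length := by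
  induction h with
  | nil => rfl
  | cons _ _ _ ih => simp [ih]

theorem Links.exists_of_append (h : Links o (γ ++ β) o' s) :
    ∃ o₁ s₁ s₂, s = s₁ ++ s₂ ∧ Links o γ o₁ s₁ ∧ Links o₁ β o' s₂ := by
  induction γ generalizing o s with
  | nil => exact ⟨o, [], s, rfl, .nil o, h⟩
  | cons X γ ih =>
    obtain _ | @⟨o₁, _, _, s, h, _, _⟩ := h
    obtain ⟨o₂, s₁, s₂, rfl, h₁, h₂⟩ := ih h
    exact ⟨o₂, _, s₂, rfl, h₁.cons o X, h₂⟩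

theorem finite_tripleRules [Finite α] : P.tripleRules.Finite := by
  have := P.finite_Q
  have := P.finite_Γ
  refine finite_of_output_length_le 3 ?_
  rintro _ (_ | _ | @⟨p, q, x, X, γ, o, s, h, hs⟩)
  · simp
  · simp
  · have hx : x.toList.length ≤ 1 := by cases x <;> simp
    have hγ := γ.2
    rw [List.length_append, List.length_map, hs.length_eq]
    lia

theorem nil_mem_acceptsFrom (ho : P.Accepting o) (β : List P.Γ) : [] ∈ P.AcceptsFrom o β := by
  cases o with
  | none => exact Language.nil_mem_one
  | some p => exact ⟨(p, β), .refl _, ho p rfl⟩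

theorem Links.append_mem_acceptsFrom (h : Links o γ o' s)
    (hv : v ∈ interpret P.tripleLanguage s) (hw : w ∈ P.AcceptsFrom o' β) :
    v ++ w ∈ P.AcceptsFrom o (γ ++ β) := by
  induction h generalizing v with
  | nil => simpa [(Language.mem_one v).1 hv] using hw
  | cons _ _ _ ih =>
    obtain ⟨v₁, hv₁, v₂, hv₂, rfl⟩ := Language.mem_mul.1 hv
    simpa using hv₁ _ _ (ih hv₂ hw)

theorem interpret_output_le_tripleLanguage {r : ContextFreeRule α (Option P.Triple)}
    (hr : r ∈ P.tripleRules) : interpret P.tripleLanguage r.output ≤ P.tripleLanguage r.input := by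
  intro v hv
  obtain @⟨o, ho⟩ | @⟨o, ho, X⟩ | @⟨p, q, x, X, γ, o, s, h, hs⟩ := hr
  · have hlinks : Links (some P.q₀) [P.Z₀] o _ := (Links.nil o).cons _ _
    change v ∈ P.AcceptsFrom (some P.q₀) [P.Z₀]
    rw [← v.append_nil]
    exact hlinks.append_mem_acceptsFrom hv (nil_mem_acceptsFrom ho [])
  · rintro β w hw
    rw [(Language.mem_one v).1 hv, (Language.mem_one w).1 hw]
    exact nil_mem_acceptsFrom ho _
  · rintro β w hw
    obtain ⟨v', rfl, hv'⟩ : ∃ v', v = x.toList ++ v' ∧ v' ∈ interpret P.tripleLanguage s := by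
      cases x with
      | none => exact ⟨v, rfl, hv⟩
      | some a =>
        obtain ⟨_, rfl, v', hv', rfl⟩ := Language.mem_mul.1 hv
        exact ⟨v', rfl, hv'⟩
    obtain ⟨c, hrun, hc⟩ := hs.append_mem_acceptsFrom hv' hw
    exact ⟨c, by simpa using Run.cons (.mk h β) hrun, hc⟩

theorem exists_links_parses_nil (ho : P.Accepting o) (β : List P.Γ) :
    ∃ o' s, P.Accepting o' ∧ Links o β o' s ∧ Parses P.tripleRules s [] := by
  induction β generalizing o with
  | nil => exact ⟨o, [], ho, .nil o, .nil⟩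
  | cons X β ih =>
    obtain ⟨o', s, ho', hs, hparse⟩ := ih (o := none) (by simp [Accepting])
    exact ⟨o', _, ho', hs.cons o X, .nonterminal (TripleRule.halt ho X) .nil hparse⟩

theorem Run.exists_links_parses {c d : P.Config} (h : P.Run c w d) (hd : d.1 ∈ P.F) :
    ∃ o s, P.Accepting o ∧ Links (some c.1) c.2 o s ∧ Parses P.tripleRules s w := by
  induction h using Run.rec_cons with
  | refl => exact exists_links_parses_nil (by simpa [Accepting] using hd) d.2
  | @cons x _ _ _ hm _ ih =>
    obtain @⟨p, q, X, γ, h, β⟩ := hm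
    obtain ⟨o, s, ho, hs, hw⟩ := ih
    obtain ⟨o₁, s₁, s₂, rfl, hs₁, hs₂⟩ := hs.exists_of_append
    obtain ⟨u, v, rfl, hu, hv⟩ := hw.exists_of_append
    refine ⟨o, _, ho, hs₂.cons (some p) X, ?_⟩
    rw [← List.append_assoc]
    exact .nonterminal (TripleRule.move h hs₁) ((Parses.map_terminal x.toList).append hu) hv

theorem mem_language_iff_parses :
    w ∈ P.language ↔ Parses P.tripleRules [.nonterminal none] w := by
  constructor
  · rintro ⟨c, hrun, hc⟩
    obtain ⟨o, s, ho, hs, hw⟩ := hrun.exists_links_parses hc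
    obtain _ | ⟨_ | _, _, _⟩ := hs
    exact .of_mem (TripleRule.start ho) hw
  · intro h
    have hw := h.mem_interpret fun _ => interpret_output_le_tripleLanguage
    rwa [interpret, interpret, mul_one] at hw

theorem isContextFree_language [Finite α] (P : PDA α) : P.language.IsContextFree :=
  isContextFree_iff_exists_parses.2
    ⟨Option P.Triple, P.tripleRules, none, finite_tripleRules, fun _ => mem_language_iff_parses⟩

end Triples

end PDA

section BlockGrammar

/-- The word `a^{m₁} # ⋯ a^{mᵣ} #` for the list `[m₁, …, mᵣ]`. -/
def blockWord (ms : List ℕ) : List BlockLetter :=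
  (ms.map fun m => List.replicate m BlockLetter.a ++ [BlockLetter.sep]).flatten

theorem blockWord_cons (m : ℕ) (ms : List ℕ) :
    blockWord (m :: ms) = List.replicate m .a ++ .sep :: blockWord ms := by
  simp [blockWord]

theorem mem_blockLanguage_iff {w : List BlockLetter} :
    w ∈ blockLanguage ↔ ∃ ms n, n ∈ ms ∧ w = blockWord ms ++ List.replicate n .b :=
  Iff.rfl

/-- The nonterminals of a grammar for `blockLanguage`: the start, one block `a^m #`, a suffix which
starts with the block that determines the number of trailing `b`s, and a sequence of blocks. -/
inductive BlockNonterminal : Type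
  | start
  | block
  | chosen
  | blocks

open BlockLetter BlockNonterminal Symbol

/-- The rules of a grammar for `blockLanguage`. -/
def blockRules : Set (ContextFreeRule BlockLetter BlockNonterminal) :=
  {⟨start, [nonterminal block, nonterminal start]⟩, ⟨start, [nonterminal chosen]⟩,
    ⟨block, [terminal a, nonterminal block]⟩, ⟨block, [terminal sep]⟩,
    ⟨chosen, [terminal a, nonterminal chosen, terminal b]⟩,
    ⟨chosen, [terminal sep, nonterminal blocks]⟩,
    ⟨blocks, []⟩, ⟨blocks, [nonterminal block, nonterminal blocks]⟩}

/-- The languages generated by the nonterminals of `blockRules`. -/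
def blockNonterminalLanguage : BlockNonterminal → Language BlockLetter
  | start => blockLanguage
  | block => {w | ∃ m, w = blockWord [m]}
  | chosen => {w | ∃ n ms, w = blockWord (n :: ms) ++ List.replicate n b}
  | blocks => {w | ∃ ms, w = blockWord ms}

theorem interpret_output_le_blockNonterminalLanguage
    {r : ContextFreeRule BlockLetter BlockNonterminal} (hr : r ∈ blockRules) :
    interpret blockNonterminalLanguage r.output ≤ blockNonterminalLanguage r.input := by
  intro w hw
  rcases hr with rfl | rfl | rfl | rfl | rfl | rfl | rfl | rfl <;>
    simp only [interpret, mul_one] at hw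
  · obtain ⟨_, ⟨m, rfl⟩, _, ⟨ms, n, hn, rfl⟩, rfl⟩ := hw
    exact ⟨m :: ms, n, by simp [hn], by simp [blockWord]⟩
  · obtain ⟨n, ms, rfl⟩ := hw
    exact ⟨n :: ms, n, by simp, rfl⟩
  · obtain ⟨_, rfl, _, ⟨m, rfl⟩, rfl⟩ := hw
    exact ⟨m + 1, by simp [blockWord, List.replicate_succ]⟩
  · obtain rfl := hw
    exact ⟨0, by simp [blockWord]⟩
  · obtain ⟨_, rfl, _, ⟨_, ⟨n, ms, rfl⟩, _, rfl, rfl⟩, rfl⟩ := hw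
    refine ⟨n + 1, ms, ?_⟩
    rw [List.replicate_succ' (a := b)]
    simp [blockWord_cons, List.replicate_succ]
  · obtain ⟨_, rfl, _, ⟨ms, rfl⟩, rfl⟩ := hw
    exact ⟨0, ms, by simp [blockWord_cons]⟩
  · obtain rfl := hw
    exact ⟨[], rfl⟩
  · obtain ⟨_, ⟨m, rfl⟩, _, ⟨ms, rfl⟩, rfl⟩ := hw
    exact ⟨m :: ms, by simp [blockWord]⟩

theorem parses_block (m : ℕ) : Parses blockRules [nonterminal block] (blockWord [m]) := by
  induction m with
  | zero => exact .of_mem (r := ⟨block, [_]⟩) (by simp [blockRules]) (.terminal sep .nil)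
  | succ m ih => exact .of_mem (r := ⟨block, [_, _]⟩) (by simp [blockRules]) (.terminal a ih)

theorem parses_blocks (ms : List ℕ) : Parses blockRules [nonterminal blocks] (blockWord ms) := by
  induction ms with
  | nil => exact .of_mem (r := ⟨blocks, []⟩) (by simp [blockRules]) .nil
  | cons m ms ih =>
    have h := (parses_block m).append ih
    have hrule : ⟨blocks, [nonterminal block, nonterminal blocks]⟩ ∈ blockRules := by
      simp [blockRules]
    exact .of_mem hrule (by simpa [blockWord] using h)

theorem parses_chosen (n : ℕ) (ms : List ℕ) :
    Parses blockRules [nonterminal chosen] (blockWord (n :: ms) ++ List.replicate n b) := by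
  induction n with
  | zero =>
    have hrule : ⟨chosen, [terminal sep, nonterminal blocks]⟩ ∈ blockRules := by
      simp [blockRules]
    exact .of_mem hrule (by simpa [blockWord_cons] using (parses_blocks ms).terminal sep)
  | succ n ih =>
    have h := (ih.append (.map_terminal [b])).terminal a
    have hrule : ⟨chosen, [terminal a, nonterminal chosen, terminal b]⟩ ∈ blockRules := by
      simp [blockRules]
    rw [List.replicate_succ' (a := b)]
    exact .of_mem hrule (by simpa [blockWord_cons, List.replicate_succ] using h)

theorem parses_start {ms : List ℕ} {n : ℕ} (hn : n ∈ ms) :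
    Parses blockRules [nonterminal start] (blockWord ms ++ List.replicate n b) := by
  induction ms with
  | nil => simp at hn
  | cons m ms ih =>
    rcases List.mem_cons.1 hn with rfl | hn
    · exact .of_mem (r := ⟨start, [_]⟩) (by simp [blockRules]) (parses_chosen n ms)
    · have h := (parses_block m).append (ih hn)
      have hrule : ⟨start, [nonterminal block, nonterminal start]⟩ ∈ blockRules := by
        simp [blockRules]
      exact .of_mem hrule (by simpa [blockWord] using h)

theorem mem_blockLanguage_iff_parses {w : List BlockLetter} :
    w ∈ blockLanguage ↔ Parses blockRules [nonterminal start] w := by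
  constructor
  · rintro ⟨ms, n, hn, rfl⟩
    exact parses_start hn
  · intro h
    have hw := h.mem_interpret fun _ => interpret_output_le_blockNonterminalLanguage
    rwa [interpret, interpret, mul_one] at hw

theorem isContextFree_blockLanguage : blockLanguage.IsContextFree := by
  have hfin : blockRules.Finite := by
    unfold blockRules
    exact Set.toFinite _
  exact isContextFree_iff_exists_parses.2
    ⟨BlockNonterminal, blockRules, start, hfin, fun _ => mem_blockLanguage_iff_parses⟩

end BlockGrammar

/-- The word `v ++ t` with its letters tagged by the part they come from. -/
def tagged {α : Type*} (v t : List α) : List (α × Bool) := v.map (·, false) ++ t.map (·, true)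

namespace PDA

variable {α : Type*} {P : PDA α}

section TwoPhase

/-- Some run accepts `v` and can be continued by `t` to an accepting run on `v ++ t`. -/
def AcceptsThrough (P : PDA α) (v t : List α) : Prop :=
  ∃ c d, P.Run P.init v c ∧ c.1 ∈ P.F ∧ P.Run c t d ∧ d.1 ∈ P.F

/-- The automaton which simulates `P` in two phases, and reads letters tagged by the current phase.
The second phase may start with any transition from an accepting state of `P`. -/
def twoPhase (P : PDA α) : PDA (α × Bool) where
  Q := P.Q × Bool
  Γ := P.Γ
  finite_Q := have := P.finite_Q; inferInstance
  finite_Γ := P.finite_Γ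
  δ p y X := {r | ∃ x : Option α, y = x.map (·, r.1.2) ∧ (r.1.1, r.2) ∈ P.δ p.1 x X ∧
    (r.1.2 = p.2 ∨ p.2 = false ∧ p.1 ∈ P.F)}
  q₀ := (P.q₀, false)
  Z₀ := P.Z₀
  F := {p | p.1 ∈ P.F ∧ p.2 = true}

/-- A configuration of `P` in a given phase. -/
def tagConfig (i : Bool) (c : P.Config) : P.twoPhase.Config := ((c.1, i), c.2)

variable {i j : Bool} {c d : P.Config} {e : P.twoPhase.Config} {v w t : List α}

theorem Move.tag {x : Option α} (h : P.Move x c d) (hij : j = i ∨ i = false ∧ c.1 ∈ P.F) :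
    P.twoPhase.Move (x.map (·, j)) (tagConfig i c) (tagConfig j d) := by
  obtain @⟨p, q, X, γ, h, β⟩ := h
  exact .mk (P := P.twoPhase) (q := (p, i)) (q' := (q, j)) ⟨x, rfl, h, hij⟩ β

theorem exists_move_of_twoPhase {y : Option (α × Bool)}
    (h : P.twoPhase.Move y (tagConfig i c) e) :
    ∃ x j d, y = x.map (·, j) ∧ e = tagConfig j d ∧ P.Move x c d ∧
      (j = i ∨ i = false ∧ c.1 ∈ P.F) := by
  obtain ⟨p, β⟩ := c
  generalize hc : tagConfig i (p, β) = c' at h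
  obtain @⟨_, q, X, γ, ⟨x, rfl, hδ, hij⟩, β'⟩ := h
  cases hc
  exact ⟨x, q.2, _, rfl, rfl, .mk hδ β', hij⟩

theorem Run.tag (i : Bool) (h : P.Run c v d) :
    P.twoPhase.Run (tagConfig i c) (v.map (·, i)) (tagConfig i d) := by
  induction h with
  | refl => exact .refl _
  | eps h _ ih => exact .eps (h.tag (.inl rfl)) ih
  | letter h _ ih => exact .letter (h.tag (.inl rfl)) ih

theorem Run.tag_switch (h : P.Run c t d) (hc : c.1 ∈ P.F) (ht : t ≠ []) :
    P.twoPhase.Run (tagConfig false c) (t.map (·, true)) (tagConfig true d) := by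
  cases h with
  | refl => exact absurd rfl ht
  | eps h hr => exact .eps (h.tag (.inr ⟨rfl, hc⟩)) (hr.tag true)
  | letter h hr => exact .letter (h.tag (.inr ⟨rfl, hc⟩)) (hr.tag true)

theorem tagConfig_inj : tagConfig i c = tagConfig j d ↔ i = j ∧ c = d :=
  ⟨fun h => ⟨congrArg (·.1.2) h, Prod.ext (congrArg (·.1.1) h) (congrArg (·.2) h)⟩,
    fun ⟨hij, hcd⟩ => hij ▸ hcd ▸ rfl⟩

theorem exists_run_of_twoPhase_true {w : List (α × Bool)}
    (h : P.twoPhase.Run (tagConfig true c) w e) :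
    ∃ t d, w = t.map (·, true) ∧ e = tagConfig true d ∧ P.Run c t d := by
  generalize hc : tagConfig true c = c' at h
  induction h using Run.rec_cons generalizing c with
  | refl => exact ⟨[], c, rfl, hc.symm, .refl c⟩
  | cons hm _ ih =>
    subst hc
    obtain ⟨x, j, d, rfl, rfl, hmove, rfl | ⟨hj, -⟩⟩ := exists_move_of_twoPhase hm
    · obtain ⟨t, e, rfl, rfl, hr⟩ := ih rfl
      exact ⟨x.toList ++ t, e, by cases x <;> simp, rfl, .cons hmove hr⟩
    · cases hj

theorem exists_run_of_twoPhase_false {w : List (α × Bool)}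
    (h : P.twoPhase.Run (tagConfig false c) w (tagConfig true d)) :
    ∃ v t c', w = tagged v t ∧ P.Run c v c' ∧ c'.1 ∈ P.F ∧ P.Run c' t d := by
  generalize hc : tagConfig false c = c' at h
  induction h using Run.rec_cons generalizing c with
  | refl => simp [tagConfig_inj] at hc
  | cons hm hr ih =>
    subst hc
    obtain ⟨x, j, c₁, rfl, rfl, hmove, hj⟩ := exists_move_of_twoPhase hm
    cases j with
    | false =>
      obtain ⟨v, t, c', rfl, hv, hc', ht⟩ := ih rfl
      exact ⟨x.toList ++ v, t, c', by cases x <;> simp [tagged], .cons hmove hv, hc', ht⟩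
    | true =>
      obtain ⟨t, d', rfl, he, hr⟩ := exists_run_of_twoPhase_true hr
      obtain ⟨-, rfl⟩ := tagConfig_inj.1 he
      exact ⟨[], x.toList ++ t, c, by cases x <;> simp [tagged], .refl c, by simpa using hj,
        .cons hmove hr⟩

theorem tagged_mem_language_twoPhase (h : P.AcceptsThrough v t) (ht : t ≠ []) :
    tagged v t ∈ P.twoPhase.language := by
  obtain ⟨c, d, hv, hc, hr, hd⟩ := h
  exact ⟨tagConfig true d, (hv.tag false).trans (hr.tag_switch hc ht), hd, rfl⟩

theorem exists_acceptsThrough_of_mem_language_twoPhase {w : List (α × Bool)}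
    (hw : w ∈ P.twoPhase.language) : ∃ v t, w = tagged v t ∧ P.AcceptsThrough v t := by
  obtain ⟨⟨⟨q, i⟩, β⟩, hr, hq, rfl⟩ := hw
  obtain ⟨v, t, c, rfl, hv, hc, ht⟩ := exists_run_of_twoPhase_false (c := P.init) (d := (q, β)) hr
  exact ⟨v, t, rfl, c, (q, β), hv, hc, ht, hq⟩

theorem AcceptsThrough.left_mem_language (h : P.AcceptsThrough v t) : v ∈ P.language := by
  obtain ⟨c, _, hv, hc, _, _⟩ := h
  exact ⟨c, hv, hc⟩

theorem AcceptsThrough.append_mem_language (h : P.AcceptsThrough v t) : v ++ t ∈ P.language := by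
  obtain ⟨_, d, hv, _, ht, hd⟩ := h
  exact ⟨d, hv.trans ht, hd⟩

end TwoPhase

section Game

variable {k : ℕ}

theorem TokenStep.run {a : α} {c d : P.Config} (h : P.TokenStep a c d) : P.Run c [a] d := by
  obtain ⟨c', hc, hm⟩ := h
  induction hc using Relation.ReflTransGen.head_induction_on with
  | refl => exact .letter hm (.refl d)
  | head h _ ih => exact .eps h ih

theorem Strategy.run_conf (σ : P.Strategy k) (l : Fin k) (v t : List α) :
    P.Run (σ.conf v l) t (σ.conf (v ++ t) l) := by
  induction t generalizing v with
  | nil => simpa using .refl _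
  | cons a t ih => simpa using (σ.conf_append v a l).run.trans (ih (v ++ [a]))

/-- Two of the `k + 1` accepted prefixes are accepted by the same token. -/
theorem IsExplorable.exists_acceptsThrough (hP : P.IsExplorable k) {w : Fin (k + 1) → List α}
    (hw : ∀ i, w i ∈ P.language) (hprefix : ∀ i j, i < j → w i <+: w j) :
    ∃ i j t, i < j ∧ w i ++ t = w j ∧ P.AcceptsThrough (w i) t := by
  obtain ⟨σ, hσ⟩ := hP
  choose token htoken using fun i => hσ (w i) (hw i)
  obtain ⟨i, j, hne, heq⟩ := Fintype.exists_ne_map_eq_of_card_lt token (by simp)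
  wlog hij : i < j generalizing i j
  · exact this j i hne.symm heq.symm (hne.lt_or_gt.resolve_left hij)
  obtain ⟨t, ht⟩ := hprefix i j hij
  have hfirst := σ.run_conf (token i) [] (w i)
  rw [σ.conf_nil] at hfirst
  exact ⟨i, j, t, hij, ht, _, _, hfirst, htoken i, σ.run_conf (token i) (w i) t,
    by rw [ht, heq]; exact htoken j⟩

end Game

end PDA

section Lists

variable {α : Type*} {c : α} {s u v x l r : List α}

theorem infix_or_infix_of_notMem (hs : c ∉ s) (h : s <:+: l ++ c :: r) : s <:+: l ∨ s <:+: r := by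
  rcases List.infix_append_iff.1 h with h | h | ⟨s₁, s₂, rfl, h₁, h₂⟩
  · exact .inl h
  · rcases List.infix_cons_iff.1 h with h | h
    · cases s <;> grind
    · exact .inr h
  · cases s₂ <;> grind

theorem length_le_of_infix_append_flatten (hv : c ∈ v) (hs : c ∉ s) (i : ℕ)
    (h : s <:+: u ++ (List.replicate i v).flatten ++ x) :
    s.length ≤ max u.length v.length + v.length + x.length := by
  obtain ⟨v₁, v₂, rfl⟩ := List.append_of_mem hv
  induction i generalizing u with
  | zero =>
    have hle := h.length_le
    grind
  | succ i ih =>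
    have hsplit : u ++ (List.replicate (i + 1) (v₁ ++ c :: v₂)).flatten ++ x =
        (u ++ v₁) ++ c :: (v₂ ++ (List.replicate i (v₁ ++ c :: v₂)).flatten ++ x) := by
      simp [List.replicate_succ]
    rcases infix_or_infix_of_notMem hs (hsplit ▸ h) with h | h
    · have hle := h.length_le
      grind
    · have hle := ih h
      grind

theorem length_lt_or_length_lt_of_notMem (hc : c ∉ v) (h : u ++ v ++ x = l ++ c :: r) :
    l.length < u.length ∨ r.length < x.length := by
  by_contra! hlen
  have hlength := congrArg List.length h
  simp only [List.length_append, List.length_cons] at hlength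
  have hlt : l.length - u.length < v.length := by lia
  have hget : v[l.length - u.length] = c := by
    have hl : (u ++ v ++ x)[l.length]? = some c := by simp [h]
    rw [List.append_assoc, List.getElem?_append_right hlen.1, List.getElem?_append_left hlt,
      List.getElem?_eq_getElem hlt] at hl
    exact Option.some.inj hl
  exact hc (hget ▸ List.getElem_mem hlt)

theorem rel_of_pairwise_pumped {R : α → α → Prop} {d : α} {y z : List α}
    (h : (u ++ (List.replicate 2 v).flatten ++ x ++ (List.replicate 2 y).flatten ++ z).Pairwise R)
    (hc : c ∈ v ++ y) (hd : d ∈ y) : R c d := by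
  have hflatten (l : List α) : (List.replicate 2 l).flatten = l ++ l := by
    simp [List.replicate_succ]
  rw [hflatten, hflatten] at h
  grind

end Lists

section Blocks

open BlockLetter

instance : DecidableEq BlockLetter := fun x y => by
  cases x <;> cases y <;> first | exact isTrue rfl | exact isFalse nofun

instance : Finite BlockLetter :=
  Set.finite_univ_iff.1 <| (Set.toFinite {a, sep, b}).subset fun c _ => by cases c <;> simp

theorem splitOn_blockWord (ms : List ℕ) :
    (blockWord ms).splitOn sep = ms.map (List.replicate · a) ++ [[]] := by
  induction ms with
  | nil => rfl
  | cons m ms ih =>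
    rw [blockWord_cons, List.splitOn_append_cons_self_of_not_mem (by simp), ih]
    rfl

theorem blockWord_injective : Function.Injective blockWord := fun ms ms' h => by
  have hmap : ms.map (List.replicate · a) = ms'.map (List.replicate · a) := by
    rw [← List.append_left_inj [[]], ← splitOn_blockWord, ← splitOn_blockWord, h]
  exact List.map_injective_iff.2 (List.replicate_left_injective a) hmap

theorem replicate_infix_blockWord {m : ℕ} {ms : List ℕ} (hm : m ∈ ms) :
    List.replicate m a <:+: blockWord ms := by
  induction ms with
  | nil => simp at hm
  | cons k ms ih =>
    rw [blockWord_cons]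
    rcases List.mem_cons.1 hm with rfl | hm
    · exact (List.prefix_append _ _).isInfix
    · exact (ih hm).trans ((List.suffix_cons _ _).trans (List.suffix_append _ _)).isInfix

theorem exists_sep_of_mem_of_ne {m m' n : ℕ} {ms : List ℕ} (hm : m ∈ ms) (hm' : m' ∈ ms)
    (hne : m ≠ m') (hn : n ≤ m) (hn' : n ≤ m') :
    ∃ l r, blockWord ms = l ++ sep :: r ∧ n ≤ l.length ∧ n ≤ r.length := by
  induction ms with
  | nil => simp at hm
  | cons k ms ih =>
    have hlength : ∀ m ∈ ms, m ≤ (blockWord ms).length := fun m hm => by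
      simpa using (replicate_infix_blockWord hm).length_le
    rw [blockWord_cons]
    rcases List.mem_cons.1 hm with rfl | hm
    · exact ⟨_, _, rfl, by simpa using hn, by grind⟩
    rcases List.mem_cons.1 hm' with rfl | hm'
    · exact ⟨_, _, rfl, by simpa using hn', by grind⟩
    obtain ⟨l, r, h, hl, hr⟩ := ih hm hm'
    exact ⟨List.replicate k a ++ sep :: l, r, by simp [h], by grind, hr⟩

/-- At most one block of a word that is pumped at a single place can be long: if the pumped part has
a separator, then no block can be long, and otherwise all separators are near the ends. -/
theorem le_length_of_blockWord_eq_append_flatten {m m' i n : ℕ} {ms : List ℕ}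
    {u v x : List BlockLetter} (h : blockWord ms = u ++ (List.replicate i v).flatten ++ x)
    (hm : m ∈ ms) (hm' : m' ∈ ms) (hne : m ≠ m') (hn : n ≤ m) (hn' : n ≤ m') :
    n ≤ u.length + 2 * v.length + x.length := by
  by_cases hv : sep ∈ v
  · have hle := length_le_of_infix_append_flatten hv (by simp) i (h ▸ replicate_infix_blockWord hm)
    rw [List.length_replicate] at hle
    lia
  · obtain ⟨l, r, hsep, hl, hr⟩ := exists_sep_of_mem_of_ne hm hm' hne hn hn'
    have hnotMem : sep ∉ (List.replicate i v).flatten := by simp [hv]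
    have hshort := length_lt_or_length_lt_of_notMem hnotMem (h.symm.trans hsep)
    lia

end Blocks

section NotExplorable

open BlockLetter

theorem filter_blockWord_append_replicate (ms : List ℕ) (n : ℕ) :
    (blockWord ms ++ List.replicate n b).filter (· ≠ b) = blockWord ms := by
  have hne : ∀ c ∈ blockWord ms, c ≠ b := by simp +contextual [blockWord, or_imp]
  simpa [List.filter_append] using hne

theorem count_blockWord_append_replicate (ms : List ℕ) (n : ℕ) :
    (blockWord ms ++ List.replicate n b).count b = n := by
  have hnotMem : b ∉ blockWord ms := by simp [blockWord]
  rw [List.count_append, List.count_eq_zero.2 hnotMem, List.count_replicate_self, zero_add]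

theorem pairwise_of_mem_blockLanguage {w : List BlockLetter} (hw : w ∈ blockLanguage) :
    w.Pairwise fun c d => c = b → d = b := by
  obtain ⟨ms, n, -, rfl⟩ := mem_blockLanguage_iff.1 hw
  have hnotMem : b ∉ blockWord ms := by simp [blockWord]
  refine List.pairwise_append.2 ⟨?_, ?_, ?_⟩
  · exact List.pairwise_of_forall_mem_list fun c hc d _ h => absurd (h ▸ hc) hnotMem
  · exact List.pairwise_of_forall_mem_list fun c _ d hd _ => List.eq_of_mem_replicate hd
  · exact fun c _ d hd _ => List.eq_of_mem_replicate hd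

/-- The part of a tagged word without the letters `b`, and without the tags. -/
def blockPart (w : List (BlockLetter × Bool)) : List BlockLetter :=
  (w.map Prod.fst).filter (· ≠ b)

theorem blockPart_append (v w : List (BlockLetter × Bool)) :
    blockPart (v ++ w) = blockPart v ++ blockPart w := by
  simp [blockPart]

theorem blockPart_flatten_replicate (v : List (BlockLetter × Bool)) (i : ℕ) :
    blockPart (List.replicate i v).flatten = (List.replicate i (blockPart v)).flatten := by
  simp [blockPart, List.filter_flatten]

/-- The tagged words `v ++ t` such that both `v` and `v ++ t` are in `blockLanguage`. -/
def taggedBlockLanguage : Language (BlockLetter × Bool) :=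
  {w | ∃ v t, w = tagged v t ∧ v ∈ blockLanguage ∧ v ++ t ∈ blockLanguage}

theorem map_fst_tagged {α : Type*} (v t : List α) : (tagged v t).map Prod.fst = v ++ t := by
  simp [tagged, Function.comp_def]

theorem pairwise_of_mem_taggedBlockLanguage {w : List (BlockLetter × Bool)}
    (hw : w ∈ taggedBlockLanguage) : w.Pairwise fun c d => c.1 = b → d.1 = b := by
  obtain ⟨v, t, rfl, -, hvt⟩ := hw
  rw [← List.pairwise_map (f := Prod.fst) (R := fun c d => c = b → d = b), map_fst_tagged]
  exact pairwise_of_mem_blockLanguage hvt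

theorem count_tagged_false (v t : List BlockLetter) (c : BlockLetter) :
    (tagged v t).count (c, false) = v.count c := by
  have hnotMem : (c, false) ∉ t.map (·, true) := by simp
  rw [tagged, List.count_append, List.count_eq_zero.2 hnotMem, add_zero]
  exact List.count_map_of_injective v _ (Prod.mk_left_injective false) c

theorem exists_blockWord_of_mem_taggedBlockLanguage {w : List (BlockLetter × Bool)}
    (hw : w ∈ taggedBlockLanguage) (hfalse : (b, false) ∈ w) (htrue : (b, true) ∈ w) :
    ∃ ms, blockPart w = blockWord ms ∧ w.count (b, false) ∈ ms ∧
      ∃ m ∈ ms, w.count (b, false) < m := by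
  obtain ⟨v, t, rfl, hv, hvt⟩ := hw
  have hbv : b ∈ v := by simpa [tagged] using hfalse
  have hbt : b ∈ t := by simpa [tagged] using htrue
  have ht : ∀ c ∈ t, c = b := fun c hc =>
    (List.pairwise_append.1 (pairwise_of_mem_blockLanguage hvt)).2.2 b hbv c hc rfl
  obtain ⟨ms, n, hn, heq⟩ := mem_blockLanguage_iff.1 hvt
  obtain ⟨ms', n', hn', rfl⟩ := mem_blockLanguage_iff.1 hv
  have hpart : blockPart (tagged (blockWord ms' ++ List.replicate n' b) t) = blockWord ms := by
    rw [blockPart, map_fst_tagged, heq, filter_blockWord_append_replicate]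
  have hms : ms' = ms := blockWord_injective <| by
    rw [← hpart, blockPart, map_fst_tagged, List.filter_append, filter_blockWord_append_replicate,
      List.filter_eq_nil_iff.2 (by simpa using ht), List.append_nil]
  have hlt : n' < n := by
    have hcount := congrArg (List.count b) heq
    rw [List.count_append, count_blockWord_append_replicate, count_blockWord_append_replicate]
      at hcount
    have hpos := List.count_pos_iff.2 hbt
    lia
  rw [count_tagged_false, count_blockWord_append_replicate]
  exact ⟨ms, hpart, hms ▸ hn', n, hn, hlt⟩

/-- Pumping letters `(b, false)` makes the shorter of the two block lengths arbitrarily large. Since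
`y` consists of letters `b` only, the blocks are pumped at a single place. -/
theorem exists_count_lt_of_le_taggedBlockLanguage {L : Language (BlockLetter × Bool)}
    (hL : L.IsContextFree) (hle : L ≤ taggedBlockLanguage) :
    ∃ n, ∀ w ∈ L, (b, true) ∈ w → w.count (b, false) < n := by
  obtain ⟨n, hn⟩ := exists_marked_pumping hL (· == (b, false))
  refine ⟨n, fun w hw htrue => ?_⟩
  by_contra! hcount
  obtain ⟨u, v, x, y, z, rfl, hmarked, hpump⟩ := hn w hw hcount
  have hmem : (b, false) ∈ v ++ y := by simpa using List.count_pos_iff.1 hmarked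
  have hy : blockPart y = [] := by
    have hall : ∀ c ∈ y, c.1 = b := fun c hc =>
      rel_of_pairwise_pumped (pairwise_of_mem_taggedBlockLanguage (hle (hpump 2))) hmem hc rfl
    simpa [blockPart, or_imp, forall_and] using hall
  set i := (blockPart u).length + 2 * (blockPart v).length + (blockPart (x ++ z)).length + 1
    with hi
  have hcount_le : i ≤ (u ++ (List.replicate i v).flatten ++ x ++ (List.replicate i y).flatten ++
      z).count (b, false) := by
    have hpos : 1 ≤ (v ++ y).count (b, false) := List.count_pos_iff.2 hmem
    have hmul := Nat.mul_le_mul_left i hpos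
    simp only [List.count_append, List.count_flatten, List.map_replicate, List.sum_replicate,
      smul_eq_mul, mul_add] at hmul ⊢
    lia
  have htrue_i : (b, true) ∈ u ++ (List.replicate i v).flatten ++ x ++
      (List.replicate i y).flatten ++ z := by
    simpa [hi] using htrue
  obtain ⟨ms, hpart, hshort, m, hm, hlt⟩ := exists_blockWord_of_mem_taggedBlockLanguage
    (hle (hpump i)) (List.count_pos_iff.1 (by lia)) htrue_i
  have hsingle : blockWord ms = blockPart u ++ (List.replicate i (blockPart v)).flatten ++
      blockPart (x ++ z) := by
    simp [← hpart, blockPart_append, blockPart_flatten_replicate, hy]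
  have hbound := le_length_of_blockWord_eq_append_flatten hsingle hshort hm hlt.ne hcount_le
    (hcount_le.trans hlt.le)
  lia

theorem blockLanguage_notMem_explCFLWith (k : ℕ) :
    blockLanguage ∉ ExplCFLWith BlockLetter k := by
  rintro ⟨P, hP, hlang⟩
  have hle : P.twoPhase.language ≤ taggedBlockLanguage := fun w hw => by
    obtain ⟨v, t, rfl, h⟩ := PDA.exists_acceptsThrough_of_mem_language_twoPhase hw
    exact ⟨v, t, rfl, hlang ▸ h.left_mem_language, hlang ▸ h.append_mem_language⟩
  obtain ⟨n, hn⟩ := exists_count_lt_of_le_taggedBlockLanguage P.twoPhase.isContextFree_language hle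
  let w (i : ℕ) : List BlockLetter := blockWord (List.range' n (k + 1)) ++ List.replicate (n + i) b
  have hw (i : Fin (k + 1)) : w i ∈ P.language :=
    hlang ▸ mem_blockLanguage_iff.2 ⟨_, n + i, List.mem_range'_1.2 (by lia), rfl⟩
  have hsucc (i d : ℕ) : w i ++ List.replicate d b = w (i + d) := by
    simp only [w, ← add_assoc, List.replicate_add (n + i), List.append_assoc]
  have hprefix (i j : Fin (k + 1)) (hij : i < j) : w i <+: w j :=
    ⟨List.replicate (j - i) b, by rw [hsucc, Nat.add_sub_cancel' hij.le]⟩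
  obtain ⟨i, j, t, hij, ht, haccepts⟩ := hP.exists_acceptsThrough hw hprefix
  have hbt : b ∈ t := by
    obtain rfl : t = List.replicate (j - i) b :=
      List.append_cancel_left (ht.trans (by rw [hsucc, Nat.add_sub_cancel' hij.le]))
    exact List.mem_replicate.2 ⟨by lia, rfl⟩
  have htagged := PDA.tagged_mem_language_twoPhase haccepts (List.ne_nil_of_mem hbt)
  have hcount := hn _ htagged (by simp [tagged, hbt])
  rw [count_tagged_false, count_blockWord_append_replicate] at hcount
  lia

end NotExplorable

theorem explCFL_subset_CFL (α : Type*) [Finite α] : ExplCFL α ⊆ CFL α := by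
  intro L hL
  obtain ⟨k, P, -, rfl⟩ := Set.mem_iUnion.1 hL
  exact P.isContextFree_language

theorem mainTheorem2 :
    (∀ (α : Type*) [Finite α], ExplCFL α ⊆ CFL α) ∧
    ExplCFL BlockLetter ⊂ CFL BlockLetter ∧
    blockLanguage ∈ CFL BlockLetter ∧
    ∀ k : ℕ, blockLanguage ∉ ExplCFLWith BlockLetter k := by
  have hblock : blockLanguage ∈ CFL BlockLetter := isContextFree_blockLanguage
  refine ⟨fun α _ => explCFL_subset_CFL α, ⟨explCFL_subset_CFL _, fun hsubset => ?_⟩, hblock,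
    blockLanguage_notMem_explCFLWith⟩
  obtain ⟨k, hk⟩ := Set.mem_iUnion.1 (hsubset hblock)
  exact blockLanguage_notMem_explCFLWith k hk
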